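/- Let $S^1=\mathbb{R}/\mathbb{Z}$ and let $\tau(x)=x+\tfrac12$ be the antipodal involution. **Definitions.** For a continuous map $g:S^1\to S^1$ put $\mathrm{Coin}(g,g\circ\tau)=\{x: g(x)=g(\tau(x))\}$, and let $\mathrm{BUCoin}(g,\tau)$ be the set of unordered pairs $\{x,\tau(x)\}$ with $x\in \mathrm{Coin}(g,g\circ\tau)$. Call a path $\gamma$ in $S^1$ *linking* if $g\circ\gamma$ and $g\circ\tau\circ\gamma$ are homotopic with fixed endpoints. Two coincidence points lie in the same usual coincidence class if a linking path joins them. Two pairs in $\mathrm{BUCoin}(g,\tau)$ lie in the same Borsuk–Ulam coincidence class if there is a linking path from a point of one pair to a point of the other. A Borsuk–Ulam class $C$ is *single* if for some pair $\{x,\tau(x)\}\in C$ there is a linking path from $x$ to $\tau(x)$; otherwise it is *double*, and the points of its pairs form two usual coincidence classes $C_1$ and $C_2=\tau(C_1)$. Suppose that $\mathrm{BUCoin}(g,\tau)$ is finite. For $x\in\mathrm{Coin}(g,g\circ\tau)$ let $\mathrm{ind}(x)\in\{-1,0,1\}$ be the local coincidence index of $(g,g\circ\tau)$ at $x$, i.e.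 the local degree of $g-g\circ\tau$ at its isolated zero $x$. The pseudo-index of $C$ is $$|\mathrm{ind}|(g,\tau;C)=\begin{cases}\displaystyle\sum_{\{x,\tau(x)\}\in C}\mathrm{ind}(x) \bmod 2 & \text{if } C \text{ is single},\\[2mm] \Bigl|\displaystyle\sum_{x\in C_1}\mathrm{ind}(x)\Bigr| & \text{if } C \text{ is double},\end{cases}$$ where one point is taken from each pair in the first sum (since $\mathrm{ind}(\tau(x))=-\mathrm{ind}(x)$, the choices do not matter). The class $C$ is *essential* if $|\mathrm{ind}|(g,\tau;C)\neq 0$. For an arbitrary continuous map $f:S^1\to S^1$, the Nielsen–Borsuk–Ulam number $NBU(f,\tau)$ is the number of essential Borsuk–Ulam coincidence classes of any map $g$ homotopic to $f$ with $\mathrm{BUCoin}(g,\tau)$ finite. **Theorem.** Let $f:S^1\to S^1$ be continuous. Then $NBU(f,\tau)$ is well defined: some map homotopic to $f$ has a finite Borsuk–Ulam coincidence set, and all such maps have the same number of essential Borsuk–Ulam coincidence classes. If the homomorphism $f_\#$ induced by $f$ on $\pi_1(S^1)\cong\mathbb{Z}$ is multiplication by $a\in\mathbb{Z}$, then $$NBU(f,\tau)=\begin{cases}1&\text{if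 } a \text{ is even},\\ 0&\text{if } a\text{ is odd}.\end{cases}$$ Moreover, there is a map $f'$ homotopic to $f$ that realizes this number, i.e. $\mathrm{BUCoin}(f',\tau)$ is finite and has exactly $NBU(f,\tau)$ elements; that is, $S^1$ is a Wecken type space in Nielsen–Borsuk–Ulam theory. -/

import Mathlib

open Topology

noncomputable section

namespace NielsenBorsukUlam

/-! ### Coincidences of `f` and `f ∘ τ` -/

section General

variable {X Y : Type*} [TopologicalSpace X] [TopologicalSpace Y]

/-- The coincidence set of the pair `(f, f ∘ τ)`. -/
def coin (f : C(X, Y)) (τ : C(X, X)) : Set X :=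
  {x | f x = f (τ x)}

/-- The Borsuk-Ulam coincidence set: the set of the (unordered) pairs `{x, τ x}`
with `f x = f (τ x)`. -/
def buCoin (f : C(X, Y)) (τ : C(X, X)) : Set (Sym2 X) :=
  (fun x => s(x, τ x)) '' coin f τ

/-- `γ` is a path such that `f ∘ γ` and `f ∘ τ ∘ γ` are homotopic with fixed endpoints. -/
def IsLinkingPath (f : C(X, Y)) (τ : C(X, X)) (γ : C(unitInterval, X)) : Prop :=
  ContinuousMap.HomotopicRel (f.comp γ) ((f.comp τ).comp γ) {0, 1}

/-- The usual (Nielsen) coincidence class of the pair `(f, f ∘ τ)` containing the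
coincidence point `x`. -/
def coinClass (f : C(X, Y)) (τ : C(X, X)) (x : X) : Set X :=
  {y | y ∈ coin f τ ∧ ∃ γ : C(unitInterval, X), γ 0 = x ∧ γ 1 = y ∧ IsLinkingPath f τ γ}

/-- The Borsuk-Ulam coincidence class of the pair `p`: all pairs `q` for which there is a linking
path from a point of `p` to a point of `q`. -/
def buClass (f : C(X, Y)) (τ : C(X, X)) (p : Sym2 X) : Set (Sym2 X) :=
  {q | q ∈ buCoin f τ ∧ ∃ γ : C(unitInterval, X), γ 0 ∈ p ∧ γ 1 ∈ q ∧ IsLinkingPath f τ γ}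

/-- The set of all Borsuk-Ulam coincidence classes. -/
def buClasses (f : C(X, Y)) (τ : C(X, X)) : Set (Set (Sym2 X)) :=
  buClass f τ '' buCoin f τ

/-- A Borsuk-Ulam coincidence class is single if for some pair `{x, τ x}` in it there is a linking
path from `x` to `τ x`; otherwise it is double. -/
def IsSingle (f : C(X, Y)) (τ : C(X, X)) (C : Set (Sym2 X)) : Prop :=
  ∃ p ∈ C, ∃ γ : C(unitInterval, X), γ 0 ∈ p ∧ γ 1 = τ (γ 0) ∧ IsLinkingPath f τ γ

end General

/-! ### The circle `ℝ / ℤ` -/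

/-- The antipodal involution `τ(x) = x + 1/2` of `S¹ = ℝ / ℤ`. -/
def antipode : C(UnitAddCircle, UnitAddCircle) where
  toFun x := x + ((1 / 2 : ℝ) : UnitAddCircle)
  continuous_toFun := by fun_prop

/-- The loop `t ↦ x + t`, `t ∈ [0, 1]`, at `x`. -/
def circleLoop (x : UnitAddCircle) : Path x x where
  toFun t := x + ((t : ℝ) : UnitAddCircle)
  continuous_toFun := by
    have h : Continuous fun r : ℝ => (r : UnitAddCircle) := AddCircle.continuous_mk' 1
    exact continuous_const.add (h.comp continuous_subtype_val)
  source' := by simp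
  target' := by simp

/-- The canonical generator of `π₁(S¹, x) ≅ ℤ`. -/
def circleGen (x : UnitAddCircle) : FundamentalGroup UnitAddCircle x :=
  FundamentalGroup.fromPath (Path.Homotopic.Quotient.mk (circleLoop x))

/-- `f_# = (a)`: the homomorphism `f_# : π₁(S¹, 0) → π₁(S¹, f 0)` sends the canonical generator to
the `a`-th power of the canonical generator. -/
def InducesMul (f : C(UnitAddCircle, UnitAddCircle)) (a : ℤ) : Prop :=
  FundamentalGroup.map f 0 (circleGen 0) = circleGen (f 0) ^ a

/-- The open half circle of the points lying on the positive side of `0`. -/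
def posSide : Set UnitAddCircle := (fun t : ℝ => (t : UnitAddCircle)) '' Set.Ioo 0 (1 / 2)

/-- The open half circle of the points lying on the negative side of `0`. -/
def negSide : Set UnitAddCircle := (fun t : ℝ => (t : UnitAddCircle)) '' Set.Ioo (-(1 / 2)) 0

open Classical in
/-- The local coincidence index of `(f, g)` at an isolated coincidence point `x` of two self-maps
of the circle: the local degree at `x` of the difference `f - g`, whose isolated zero is `x`.
In dimension one this is `1` if `f - g` passes from the negative to the positive side of `0` as its
argument passes through `x` in the positive direction, `-1` if it passes from the positive to the
negative side, and `0` if it stays on one side. -/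
def localIndex (f g : C(UnitAddCircle, UnitAddCircle)) (x : UnitAddCircle) : ℤ :=
  if (∀ᶠ t : ℝ in 𝓝[<] 0, f (x + (t : UnitAddCircle)) - g (x + (t : UnitAddCircle)) ∈ negSide) ∧
      (∀ᶠ t : ℝ in 𝓝[>] 0, f (x + (t : UnitAddCircle)) - g (x + (t : UnitAddCircle)) ∈ posSide)
  then 1
  else if
      (∀ᶠ t : ℝ in 𝓝[<] 0, f (x + (t : UnitAddCircle)) - g (x + (t : UnitAddCircle)) ∈ posSide) ∧
      (∀ᶠ t : ℝ in 𝓝[>] 0, f (x + (t : UnitAddCircle)) - g (x + (t : UnitAddCircle)) ∈ negSide)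
  then -1
  else 0

/-- The local index `ind(f, f ∘ τ; x)`, for `τ` the antipodal involution. -/
def ind (f : C(UnitAddCircle, UnitAddCircle)) (x : UnitAddCircle) : ℤ :=
  localIndex f (f.comp antipode) x

/-- A chosen point of a chosen pair of the Borsuk-Ulam class `C`. -/
def basePoint (C : Set (Sym2 UnitAddCircle)) : UnitAddCircle :=
  (Classical.epsilon fun p => p ∈ C).out.1

open Classical in
/-- The pseudo-index `|ind|(f, τ; C)` of a Borsuk-Ulam coincidence class `C` (with finite
coincidence set), in the case relevant here: the dimension `1` is odd and the antipodal involution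
preserves the orientation. If `C` is single, it is the sum, over the pairs in `C`, of the index of
one point of each pair, reduced mod 2; the choice of the points is immaterial because
`ind(f, f ∘ τ; τ x) = - ind(f, f ∘ τ; x)`. If `C` is double, the points of its pairs form two usual
coincidence classes `C₁` and `C₂ = τ C₁`, and the pseudo-index is `|ind(f, f ∘ τ; C₁)|`, which is
equal to `|ind(f, f ∘ τ; C₂)|`. -/
def pseudoIndex (f : C(UnitAddCircle, UnitAddCircle)) (C : Set (Sym2 UnitAddCircle)) : ℤ :=
  if IsSingle f antipode C then (∑ᶠ p ∈ C, ind f p.out.1) % 2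
  else |∑ᶠ x ∈ coinClass f antipode (basePoint C), ind f x|

/-- The number of essential Borsuk-Ulam coincidence classes of `(f, τ)`, for `f` with finite
Borsuk-Ulam coincidence set. -/
def essentialCount (f : C(UnitAddCircle, UnitAddCircle)) : ℕ :=
  {C | C ∈ buClasses f antipode ∧ pseudoIndex f C ≠ 0}.ncard

/-- The Nielsen-Borsuk-Ulam number `NBU(f, τ)`, for `τ` the antipodal involution of the circle: the
number of essential Borsuk-Ulam coincidence classes of a map homotopic to `f` with finite
Borsuk-Ulam coincidence set. -/
def NBU (f : C(UnitAddCircle, UnitAddCircle)) : ℕ :=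
  essentialCount
    (Classical.epsilon fun g => ContinuousMap.Homotopic f g ∧ (buCoin g antipode).Finite)

end NielsenBorsukUlam

end

/-!
The proof replaces the circle-valued map `f - f ∘ τ` by a real function. Since `τ` is homotopic to
the identity, `f - f ∘ τ` is null-homotopic and lifts to a continuous `D : S¹ → ℝ`
(`exists_isDifferenceLift`). A point is a coincidence exactly when `D` is an integer there, and a
path between coincidences is linking exactly when `D` agrees at its ends
(`IsDifferenceLift.isLinkingPath_iff`). So the usual coincidence classes are the integer level sets
of `D`. As `D + D ∘ τ` is an integer constant `c`, the involution exchanges the levels `k` and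
`c - k`: a Borsuk-Ulam class consists of the pairs lying on two such levels, and it is single
exactly when `2 * k = c`.

The local index at a coincidence on level `k` is the sign change of `D - k`
(`IsDifferenceLift.ind_coe`), and the sign changes of a real function on an interval add up to half
the difference of its signs at the ends (`two_mul_finsum_crossIndex`). Over the whole circle this
gives `0`, so double classes are inessential (`IsDifferenceLift.finsum_ind_level`). If `c = 2 * k`,
then `D - k` is odd under `τ`, so over half a circle the sum is `1` or `-1`; the class at level `k`
is therefore present and essential (`IsDifferenceLift.odd_finsum_ind_out`). The number of essential
classes is thus `1` for even `c` and `0` for odd `c`.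

A homotopy from `f` to `g` changes `D` by `u - u ∘ τ` for some real function `u`, which leaves `c`
unchanged; and `c` has the parity of the degree of `f` (`InducesMul.even_iff`). Conversely a
suitable `u` turns `D - c / 2` into any prescribed odd function. The zero function for odd `c`, and
`sin (2 * π * x) / 2` for even `c`, give maps with no pair and with one pair of coincidences
(`IsDifferenceLift.exists_homotopic_ncard_eq`).
-/

noncomputable section

namespace NielsenBorsukUlam

/-! ### Real-valued lifts of differences of circle maps -/

/-- `D` is a real-valued lift of the circle-valued map `f - f ∘ τ`. Such a lift exists on all of
the circle, because `f - f ∘ τ` has degree `0`; it is unique up to an integer constant. -/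
def IsDifferenceLift (f : C(UnitAddCircle, UnitAddCircle)) (D : C(UnitAddCircle, ℝ)) : Prop :=
  ∀ x, (D x : UnitAddCircle) = f x - f (antipode x)

theorem isCoveringMap_coe_unitAddCircle : IsCoveringMap ((↑) : ℝ → UnitAddCircle) :=
  AddCircle.isCoveringMap_coe 1

theorem coe_unitAddCircle_eq_zero_iff {r : ℝ} : (r : UnitAddCircle) = 0 ↔ ∃ k : ℤ, r = k := by
  rw [AddCircle.coe_eq_zero_iff]
  simp [eq_comm]

theorem antipode_coe (t : ℝ) : antipode (t : UnitAddCircle) = ((t + 1 / 2 : ℝ) : UnitAddCircle) :=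
  rfl

theorem antipode_antipode (x : UnitAddCircle) : antipode (antipode x) = x := by
  have h : ((1 / 2 : ℝ) : UnitAddCircle) + ((1 / 2 : ℝ) : UnitAddCircle) = 0 := by
    rw [← AddCircle.coe_add, coe_unitAddCircle_eq_zero_iff]
    exact ⟨1, by norm_num⟩
  simp only [antipode, ContinuousMap.coe_mk, add_assoc, h, add_zero]

/-- The difference of two homotopic circle-valued maps lifts to the real line: the difference is
homotopic to `0`, and this homotopy is lifted from the zero map. -/
theorem exists_lift_sub_of_homotopic {X : Type*} [TopologicalSpace X] {f g : C(X, UnitAddCircle)}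
    (h : ContinuousMap.Homotopic f g) :
    ∃ u : C(X, ℝ), ∀ x, (u x : UnitAddCircle) = g x - f x := by
  obtain ⟨H⟩ := h
  let K : C(unitInterval × X, UnitAddCircle) :=
    ⟨fun p => H p - f p.2, by fun_prop⟩
  have K0 : ∀ x, K (0, x) = ((0 : C(X, ℝ)) x : UnitAddCircle) := fun x => by simp [K]
  let L := isCoveringMap_coe_unitAddCircle.liftHomotopy K 0 K0
  refine ⟨⟨fun x => L (1, x), by fun_prop⟩, fun x => ?_⟩
  have := congrFun (isCoveringMap_coe_unitAddCircle.liftHomotopy_lifts K 0 K0) (1, x)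
  exact this.trans (by simp [K])

theorem homotopic_of_lift_sub {X : Type*} [TopologicalSpace X] {f g : C(X, UnitAddCircle)}
    (u : C(X, ℝ)) (h : ∀ x, (u x : UnitAddCircle) = g x - f x) :
    ContinuousMap.Homotopic f g := by
  have hc : Continuous fun r : ℝ => (r : UnitAddCircle) := AddCircle.continuous_mk' 1
  refine ⟨⟨⟨fun p => f p.2 + (((p.1 : ℝ) * u p.2 : ℝ) : UnitAddCircle), ?_⟩, ?_, ?_⟩⟩
  · exact (by fun_prop : Continuous fun p : unitInterval × X => f p.2).add (hc.comp (by fun_prop))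
  · intro x; simp
  · intro x; simp [h]

theorem homotopic_id_antipode :
    ContinuousMap.Homotopic (ContinuousMap.id UnitAddCircle) antipode :=
  homotopic_of_lift_sub (.const _ (1 / 2)) fun x => by simp [antipode]

theorem exists_isDifferenceLift (f : C(UnitAddCircle, UnitAddCircle)) :
    ∃ D, IsDifferenceLift f D := by
  have h : ContinuousMap.Homotopic (f.comp antipode) f := by
    simpa using ((ContinuousMap.Homotopic.refl f).comp homotopic_id_antipode).symm
  obtain ⟨D, hD⟩ := exists_lift_sub_of_homotopic h
  exact ⟨D, hD⟩

section Lift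

variable {f : C(UnitAddCircle, UnitAddCircle)} {D : C(UnitAddCircle, ℝ)}

theorem IsDifferenceLift.mem_coin_iff (hD : IsDifferenceLift f D) {x : UnitAddCircle} :
    x ∈ coin f antipode ↔ ∃ k : ℤ, D x = k := by
  rw [← coe_unitAddCircle_eq_zero_iff, hD x, sub_eq_zero]
  rfl

theorem antipode_mem_coin {x : UnitAddCircle} (hx : x ∈ coin f antipode) :
    antipode x ∈ coin f antipode := by
  change f _ = f _
  rw [antipode_antipode]
  exact hx.symm

/-- `D + D ∘ τ` is an integer constant, being a lift of `0`. Its parity is that of the degree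
of `f`. -/
theorem IsDifferenceLift.exists_add_antipode (hD : IsDifferenceLift f D) :
    ∃ c : ℤ, ∀ x, D x + D (antipode x) = c := by
  have h0 : ∀ x, ((D x + D (antipode x) : ℝ) : UnitAddCircle) = 0 := fun x => by
    rw [AddCircle.coe_add, hD, hD, antipode_antipode]
    abel
  obtain ⟨c, hc⟩ := coe_unitAddCircle_eq_zero_iff.1 (h0 0)
  refine ⟨c, fun x => ?_⟩
  rw [← hc]
  exact isCoveringMap_coe_unitAddCircle.const_of_comp
    (g := fun x => D x + D (antipode x)) (by fun_prop) (fun a b => by rw [h0, h0]) x 0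

theorem IsDifferenceLift.of_lift_sub {g : C(UnitAddCircle, UnitAddCircle)}
    {u : C(UnitAddCircle, ℝ)} (hD : IsDifferenceLift f D)
    (hu : ∀ x, (u x : UnitAddCircle) = g x - f x) :
    IsDifferenceLift g (D + u - u.comp antipode) := fun x => by
  simp only [ContinuousMap.sub_apply, ContinuousMap.add_apply, ContinuousMap.comp_apply,
    AddCircle.coe_sub, AddCircle.coe_add, hD x, hu]
  abel

/-! ### Linking paths and coincidence classes -/

/-- A path is linking if and only if `D` takes the same integer value at its endpoints: `D ∘ γ`
lifts the difference of the two image paths, which is null-homotopic relative to the endpoints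
exactly when that lift is closed. -/
theorem IsDifferenceLift.isLinkingPath_iff (hD : IsDifferenceLift f D)
    (γ : C(unitInterval, UnitAddCircle)) :
    IsLinkingPath f antipode γ ↔ D (γ 0) = D (γ 1) ∧ γ 0 ∈ coin f antipode := by
  have hc : Continuous fun r : ℝ => (r : UnitAddCircle) := AddCircle.continuous_mk' 1
  constructor
  · rintro ⟨H⟩
    have h0 : γ 0 ∈ coin f antipode := by
      have h1 := H.eq_fst 1 (x := 0) (by simp)
      have h2 := H.apply_one 0
      exact h1.symm.trans h2
    refine ⟨?_, h0⟩
    obtain ⟨k, hk⟩ := hD.mem_coin_iff.1 h0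
    let δ : C(unitInterval, UnitAddCircle) := ⟨fun t => f (γ t) - f (antipode (γ t)), by fun_prop⟩
    have hδ : δ.HomotopicRel (.const _ 0) {0, 1} := by
      refine ⟨⟨⟨⟨fun p => H p - f (antipode (γ p.2)), by fun_prop⟩, ?_, ?_⟩, ?_⟩⟩
      · intro t; simp [δ]
      · intro t; simp
      · intro s t ht
        have := H.eq_fst s ht
        simp [δ] at this ⊢
        rw [this]
    have e0 : δ 0 = ((D (γ 0) : ℝ) : UnitAddCircle) := (hD _).symm
    have e1 : (ContinuousMap.const unitInterval (0 : UnitAddCircle)) 0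
        = ((D (γ 0) : ℝ) : UnitAddCircle) := by
      rw [hk]; exact (coe_unitAddCircle_eq_zero_iff.2 ⟨k, rfl⟩).symm
    have key := isCoveringMap_coe_unitAddCircle.liftPath_apply_one_eq_of_homotopicRel hδ
      (D (γ 0)) e0 e1
    erw [isCoveringMap_coe_unitAddCircle.liftPath_const e1] at key
    have hl := (isCoveringMap_coe_unitAddCircle.eq_liftPath_iff' e0 (Γ := D.comp γ)).2
      ⟨funext fun t => hD (γ t), rfl⟩
    rw [← hl] at key
    exact key.symm
  · rintro ⟨h1, h0⟩
    obtain ⟨k, hk⟩ := hD.mem_coin_iff.1 h0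
    have hk0 : ((k : ℝ) : UnitAddCircle) = 0 := coe_unitAddCircle_eq_zero_iff.2 ⟨k, rfl⟩
    refine ⟨⟨⟨⟨fun p => f (γ p.2) - (((p.1 : ℝ) * (D (γ p.2) - k) : ℝ) : UnitAddCircle), ?_⟩,
      ?_, ?_⟩, ?_⟩⟩
    · exact (by fun_prop : Continuous fun p : unitInterval × unitInterval => f (γ p.2)).sub
        (hc.comp (by fun_prop))
    · intro t; simp
    · intro t; simp [hD (γ t), hk0]
    · rintro s t (rfl | rfl)
      · simp [hk]
      · simp [← h1, hk]

theorem exists_path_map (x y : UnitAddCircle) :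
    ∃ γ : C(unitInterval, UnitAddCircle), γ 0 = x ∧ γ 1 = y :=
  ⟨(PathConnectedSpace.somePath x y).toContinuousMap,
    (PathConnectedSpace.somePath x y).source, (PathConnectedSpace.somePath x y).target⟩

theorem IsDifferenceLift.mem_coinClass_iff (hD : IsDifferenceLift f D) {x y : UnitAddCircle}
    (hx : x ∈ coin f antipode) : y ∈ coinClass f antipode x ↔ D y = D x := by
  constructor
  · rintro ⟨-, γ, rfl, rfl, h⟩
    exact ((hD.isLinkingPath_iff γ).1 h).1.symm
  · intro h
    obtain ⟨γ, rfl, rfl⟩ := exists_path_map x y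
    refine ⟨?_, γ, rfl, rfl, (hD.isLinkingPath_iff γ).2 ⟨h.symm, hx⟩⟩
    rw [hD.mem_coin_iff] at hx ⊢
    rwa [h]

theorem mem_buCoin_of_mem_coin {x : UnitAddCircle} (hx : x ∈ coin f antipode) :
    s(x, antipode x) ∈ buCoin f antipode :=
  ⟨x, hx, rfl⟩

theorem mem_coin_of_mem {p : Sym2 UnitAddCircle} (hp : p ∈ buCoin f antipode)
    {x : UnitAddCircle} (hx : x ∈ p) : x ∈ coin f antipode := by
  obtain ⟨y, hy, rfl⟩ := hp
  rcases Sym2.mem_iff.1 hx with rfl | rfl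
  exacts [hy, antipode_mem_coin hy]

theorem eq_mk_antipode {p : Sym2 UnitAddCircle} (hp : p ∈ buCoin f antipode)
    {x : UnitAddCircle} (hx : x ∈ p) : p = s(x, antipode x) := by
  obtain ⟨y, hy, rfl⟩ := hp
  rcases Sym2.mem_iff.1 hx with rfl | rfl
  · rfl
  · simp only [antipode_antipode]
    exact Sym2.eq_swap

theorem IsDifferenceLift.mem_buClass_iff (hD : IsDifferenceLift f D) {p q : Sym2 UnitAddCircle}
    (hp : p ∈ buCoin f antipode) :
    q ∈ buClass f antipode p ↔ q ∈ buCoin f antipode ∧ ∃ x ∈ p, ∃ y ∈ q, D x = D y := by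
  refine and_congr_right fun hq => ⟨?_, ?_⟩
  · rintro ⟨γ, h0, h1, h⟩
    exact ⟨_, h0, _, h1, ((hD.isLinkingPath_iff γ).1 h).1⟩
  · rintro ⟨x, hx, y, hy, h⟩
    obtain ⟨γ, rfl, rfl⟩ := exists_path_map x y
    exact ⟨γ, hx, hy, (hD.isLinkingPath_iff γ).2 ⟨h, mem_coin_of_mem hp hx⟩⟩

theorem finite_coin (h : (buCoin f antipode).Finite) : (coin f antipode).Finite := by
  refine (h.biUnion fun p _ => (p.toFinset.finite_toSet)).subset fun x hx => ?_
  exact Set.mem_biUnion (mem_buCoin_of_mem_coin hx) (by simp)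

end Lift

/-! ### The degree -/

/-- The `a`-th power of the generator of the fundamental group translates the fibre of the
universal covering by `a`. -/
theorem monodromy_circleGen_zpow (x : UnitAddCircle) (a : ℤ)
    (e : ((↑) : ℝ → UnitAddCircle) ⁻¹' {x}) :
    (isCoveringMap_coe_unitAddCircle.monodromyPerm x (circleGen x ^ a) e : ℝ) = e + a := by
  have h1 : ∀ e : ((↑) : ℝ → UnitAddCircle) ⁻¹' {x},
      (isCoveringMap_coe_unitAddCircle.monodromyPerm x (circleGen x) e : ℝ) = e + 1 := by
    intro e
    have h0 : (circleLoop x : C(unitInterval, UnitAddCircle)) 0 = ((e : ℝ) : UnitAddCircle) := by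
      rw [show ((e : ℝ) : UnitAddCircle) = x from e.2]
      exact (circleLoop x).source
    have h2 := (isCoveringMap_coe_unitAddCircle.eq_liftPath_iff' h0
      (Γ := ⟨fun t => (e : ℝ) + t, by fun_prop⟩)).2 ⟨funext fun t => ?_, by simp⟩
    · have h3 := DFunLike.congr_fun h2 1
      exact h3.symm.trans (by simp)
    · have : ((e : ℝ) : UnitAddCircle) = x := e.2
      simp [circleLoop, this]
  rw [map_zpow]
  induction a using Int.induction_on generalizing e with
  | zero => simp
  | succ n ih =>
    rw [zpow_add_one, Equiv.Perm.mul_apply, ih, h1]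
    push_cast
    ring
  | pred n ih =>
    rw [zpow_sub_one, Equiv.Perm.mul_apply, ih]
    have := h1 ((isCoveringMap_coe_unitAddCircle.monodromyPerm x (circleGen x))⁻¹ e)
    rw [← Equiv.Perm.mul_apply, mul_inv_cancel, Equiv.Perm.one_apply] at this
    rw [this]
    push_cast
    ring

theorem InducesMul.exists_lift {f : C(UnitAddCircle, UnitAddCircle)} {a : ℤ}
    (h : InducesMul f a) :
    ∃ F : C(unitInterval, ℝ), (∀ t : unitInterval, (F t : UnitAddCircle) = f ((t : ℝ) : UnitAddCircle))
      ∧ F 1 = F 0 + a := by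
  obtain ⟨e, he⟩ := QuotientAddGroup.mk_surjective (f 0)
  have h1 := monodromy_circleGen_zpow (f 0) a ⟨e, he⟩
  rw [← h] at h1
  have h0 : ((circleLoop 0).map f.continuous : C(unitInterval, UnitAddCircle)) 0
      = (e : UnitAddCircle) := by
    rw [show (e : UnitAddCircle) = f 0 from he]
    exact ((circleLoop 0).map f.continuous).source
  let F := isCoveringMap_coe_unitAddCircle.liftPath _ e h0
  refine ⟨F, fun t => ?_, ?_⟩
  · have := congrFun (isCoveringMap_coe_unitAddCircle.liftPath_lifts _ e h0) t
    exact this.trans (by simp [circleLoop])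
  · rw [show F 0 = e from isCoveringMap_coe_unitAddCircle.liftPath_zero _ e h0]
    exact h1

/-- With `F` a lift of `f` along the generating loop, `F t - F (t + 1/2) - D t` is an integer
constant `m` for `0 ≤ t ≤ 1/2`; its values at the ends add up to `2 * m = - a - c`. -/
theorem InducesMul.even_iff {f : C(UnitAddCircle, UnitAddCircle)} {a : ℤ} (h : InducesMul f a)
    {D : C(UnitAddCircle, ℝ)} (hD : IsDifferenceLift f D) {c : ℤ}
    (hc : ∀ x, D x + D (antipode x) = c) : Even a ↔ Even c := by
  obtain ⟨F, hF, hF1⟩ := h.exists_lift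
  have hco : Continuous fun r : ℝ => (r : UnitAddCircle) := AddCircle.continuous_mk' 1
  have m1 : ∀ t : unitInterval, (t : ℝ) / 2 ∈ unitInterval := fun t => by
    have := t.2.1; have := t.2.2; constructor <;> linarith
  have m2 : ∀ t : unitInterval, ((t : ℝ) + 1) / 2 ∈ unitInterval := fun t => by
    have := t.2.1; have := t.2.2; constructor <;> linarith
  let G : unitInterval → ℝ := fun t =>
    F ⟨(t : ℝ) / 2, m1 t⟩ - F ⟨((t : ℝ) + 1) / 2, m2 t⟩ - D (((t : ℝ) / 2 : ℝ) : UnitAddCircle)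
  have hG : Continuous G := by
    refine ((F.continuous.comp ?_).sub (F.continuous.comp ?_)).sub
      (D.continuous.comp (hco.comp ?_)) <;> fun_prop
  have hG0 : ∀ t, (G t : UnitAddCircle) = 0 := fun t => by
    simp only [G, AddCircle.coe_sub, hF, hD _, antipode_coe]
    rw [show (t : ℝ) / 2 + 1 / 2 = ((t : ℝ) + 1) / 2 by ring]
    abel
  have hcst := isCoveringMap_coe_unitAddCircle.const_of_comp hG
    (fun a b => by rw [hG0, hG0]) 0 1
  obtain ⟨m, hm⟩ := coe_unitAddCircle_eq_zero_iff.1 (hG0 0)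
  have hm1 : G 1 = m := hcst.symm.trans hm
  have e0 : G 0 = F 0 - F ⟨1 / 2, by norm_num⟩ - D 0 := by
    simp only [G]; congr 3 <;> simp
  have e1 : G 1 = F ⟨1 / 2, by norm_num⟩ - F 1 - D (antipode 0) := by
    have h2 : antipode 0 = ((1 / 2 : ℝ) : UnitAddCircle) := by simp [antipode]
    rw [h2]
    simp only [G]; congr 3
    exact Subtype.ext (by norm_num)
  have h3 : (a : ℝ) + c = -2 * m := by
    have := hc 0
    linarith
  have h4 : a + c = 2 * (-m) := by
    have : ((a + c : ℤ) : ℝ) = ((2 * (-m) : ℤ) : ℝ) := by push_cast; linarith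
    exact_mod_cast this
  have h5 : Even (a + c) := h4 ▸ even_two_mul _
  exact Int.even_add.1 h5

/-! ### Sign changes of real functions -/

open Classical in
/-- The sign change of `φ` at `z`: `1` if `φ` passes from negative to positive values, `-1` if it
passes from positive to negative values, and `0` otherwise. -/
def crossIndex (φ : ℝ → ℝ) (z : ℝ) : ℤ :=
  if (∀ᶠ t in 𝓝[<] (0 : ℝ), φ (z + t) < 0) ∧ (∀ᶠ t in 𝓝[>] (0 : ℝ), 0 < φ (z + t)) then 1
  else if (∀ᶠ t in 𝓝[<] (0 : ℝ), 0 < φ (z + t)) ∧ (∀ᶠ t in 𝓝[>] (0 : ℝ), φ (z + t) < 0) then -1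
  else 0

theorem not_eventually_neg_and_pos {φ : ℝ → ℝ} {l : Filter ℝ} [l.NeBot]
    (h1 : ∀ᶠ t in l, φ t < 0) (h2 : ∀ᶠ t in l, 0 < φ t) : False := by
  obtain ⟨t, h3, h4⟩ := (h1.and h2).exists
  exact h3.not_gt h4

theorem crossIndex_eq_neg {φ : ℝ → ℝ} {z w : ℝ} (h : ∀ t, φ (w + t) = -φ (z + t)) :
    crossIndex φ w = -crossIndex φ z := by
  have hn : ∀ l : Filter ℝ, (∀ᶠ t in l, φ (w + t) < 0) ↔ ∀ᶠ t in l, 0 < φ (z + t) := fun l => by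
    simp only [h, Left.neg_neg_iff]
  have hp : ∀ l : Filter ℝ, (∀ᶠ t in l, 0 < φ (w + t)) ↔ ∀ᶠ t in l, φ (z + t) < 0 := fun l => by
    simp only [h, Left.neg_pos_iff]
  classical
  unfold crossIndex
  rw [if_congr (and_congr (hn _) (hp _)) rfl (if_congr (and_congr (hp _) (hn _)) rfl rfl)]
  split_ifs with h1 h2
  · exact (not_eventually_neg_and_pos h2.1 h1.1).elim
  all_goals simp

theorem sign_eq_of_forall_ne_zero {φ : ℝ → ℝ} (hφ : Continuous φ) {a b : ℝ} (hab : a ≤ b)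
    (h : ∀ t ∈ Set.Icc a b, φ t ≠ 0) : SignType.sign (φ a) = SignType.sign (φ b) := by
  have ha := h a ⟨le_rfl, hab⟩
  have hb := h b ⟨hab, le_rfl⟩
  rcases lt_or_gt_of_ne ha with ha | ha <;> rcases lt_or_gt_of_ne hb with hb | hb
  · rw [sign_neg ha, sign_neg hb]
  · obtain ⟨t, ht, h0⟩ := intermediate_value_Icc hab hφ.continuousOn ⟨ha.le, hb.le⟩
    exact (h t ht h0).elim
  · obtain ⟨t, ht, h0⟩ := intermediate_value_Icc' hab hφ.continuousOn ⟨hb.le, ha.le⟩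
    exact (h t ht h0).elim
  · rw [sign_pos ha, sign_pos hb]

theorem two_mul_crossIndex {φ : ℝ → ℝ} (hφ : Continuous φ) {a z b : ℝ} (haz : a < z) (hzb : z < b)
    (h : ∀ t ∈ Set.Icc a b, t ≠ z → φ t ≠ 0) :
    2 * crossIndex φ z = (SignType.sign (φ b) : ℤ) - (SignType.sign (φ a) : ℤ) := by
  have hl : ∀ᶠ t in 𝓝[<] (0 : ℝ), SignType.sign (φ (z + t)) = SignType.sign (φ a) := by
    filter_upwards [Ioo_mem_nhdsLT (show a - z < 0 by linarith)] with t ht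
    refine (sign_eq_of_forall_ne_zero hφ (by linarith [ht.1]) fun s hs => ?_).symm
    exact h s ⟨hs.1, by linarith [hs.2, ht.2]⟩ (by linarith [hs.2, ht.2] : s < z).ne
  have hr : ∀ᶠ t in 𝓝[>] (0 : ℝ), SignType.sign (φ (z + t)) = SignType.sign (φ b) := by
    filter_upwards [Ioo_mem_nhdsGT (show 0 < b - z by linarith)] with t ht
    refine sign_eq_of_forall_ne_zero hφ (by linarith [ht.2]) fun s hs => ?_
    exact h s ⟨by linarith [hs.1, ht.1], hs.2⟩ (by linarith [hs.1, ht.1] : z < s).ne'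
  have ha := h a ⟨le_rfl, by linarith⟩ haz.ne
  have hb := h b ⟨by linarith, le_rfl⟩ hzb.ne'
  -- Each of the four sign patterns decides all the conditions in the definition of the index.
  have hconst : ∀ {l : Filter ℝ} [l.NeBot] {s : SignType} (r : SignType),
      (∀ᶠ t in l, SignType.sign (φ (z + t)) = s) →
      ((∀ᶠ t in l, SignType.sign (φ (z + t)) = r) ↔ s = r) := fun {l} _ {s} r hs =>
    (Filter.eventually_congr (hs.mono fun t ht => by rw [ht])).trans Filter.eventually_const
  have hln := hconst (-1) hl
  have hlp := hconst 1 hl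
  have hrn := hconst (-1) hr
  have hrp := hconst 1 hr
  simp only [sign_eq_neg_one_iff, sign_eq_one_iff] at hln hlp hrn hrp
  classical
  unfold crossIndex
  rw [if_congr (and_congr hln hrp) rfl (if_congr (and_congr hlp hrn) rfl rfl)]
  rcases lt_or_gt_of_ne ha with ha | ha <;> rcases lt_or_gt_of_ne hb with hb | hb
  · simp [ha, hb, ha.not_gt, hb.not_gt]
  · simp [ha, hb]
  · simp [ha, hb, ha.not_gt]
  · simp [ha, hb, ha.not_gt, hb.not_gt]

theorem two_mul_sum_crossIndex {φ : ℝ → ℝ} (hφ : Continuous φ) {b : ℝ} (hb : φ b ≠ 0) (n : ℕ) :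
    ∀ {a : ℝ}, a < b → φ a ≠ 0 → ∀ S : Finset ℝ, S.card = n →
      (∀ t, t ∈ S ↔ t ∈ Set.Ioo a b ∧ φ t = 0) →
      2 * ∑ t ∈ S, crossIndex φ t = (SignType.sign (φ b) : ℤ) - (SignType.sign (φ a) : ℤ) := by
  induction n with
  | zero =>
    intro a hab ha S hS hmem
    obtain rfl := Finset.card_eq_zero.1 hS
    rw [sign_eq_of_forall_ne_zero hφ hab.le, Finset.sum_empty, sub_self, mul_zero]
    intro t ht h0
    rcases eq_or_ne t a with rfl | h1
    · exact ha h0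
    rcases eq_or_ne t b with rfl | h2
    · exact hb h0
    exact Finset.notMem_empty _
      ((hmem t).2 ⟨⟨lt_of_le_of_ne ht.1 h1.symm, lt_of_le_of_ne ht.2 h2⟩, h0⟩)
  | succ n ih =>
    intro a hab ha S hS hmem
    have hne : S.Nonempty := Finset.card_pos.1 (by omega)
    obtain ⟨z, hzS, hzmin⟩ : ∃ z ∈ S, ∀ t ∈ S, z ≤ t :=
      ⟨S.min' hne, S.min'_mem hne, fun t ht => S.min'_le t ht⟩
    obtain ⟨⟨haz, hzb⟩, hz0⟩ := (hmem z).1 hzS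
    -- A point `c` separating the smallest zero `z` from the other zeros and from `b`.
    obtain ⟨c, hzc, hcb, hcS⟩ : ∃ c, z < c ∧ c < b ∧ ∀ t ∈ S, t ≠ z → c < t := by
      have hT : (insert b (S.erase z)).Nonempty := Finset.insert_nonempty _ _
      have hlt : z < (insert b (S.erase z)).min' hT := by
        rw [Finset.lt_min'_iff]
        intro t ht
        rcases Finset.mem_insert.1 ht with rfl | ht
        · exact hzb
        · exact lt_of_le_of_ne (hzmin t (Finset.mem_of_mem_erase ht))
            (Finset.ne_of_mem_erase ht).symm
      obtain ⟨c, h1, h2⟩ := exists_between hlt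
      rw [Finset.lt_min'_iff] at h2
      exact ⟨c, h1, h2 b (Finset.mem_insert_self _ _), fun t ht htz =>
        h2 t (Finset.mem_insert_of_mem (Finset.mem_erase.2 ⟨htz, ht⟩))⟩
    have hnz : ∀ t ∈ Set.Icc a c, t ≠ z → φ t ≠ 0 := by
      intro t ht htz h0
      rcases eq_or_ne t a with rfl | h1
      · exact ha h0
      have := hcS t ((hmem t).2 ⟨⟨lt_of_le_of_ne ht.1 h1.symm, ht.2.trans_lt hcb⟩, h0⟩) htz
      exact this.not_ge ht.2
    have hc : φ c ≠ 0 := hnz c ⟨(haz.trans hzc).le, le_rfl⟩ hzc.ne'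
    have h1 := two_mul_crossIndex hφ haz hzc hnz
    have h2 := ih hcb hc (S.erase z) (by rw [Finset.card_erase_of_mem hzS]; omega) fun t => by
      rw [Finset.mem_erase, hmem]
      constructor
      · rintro ⟨htz, ht, h0⟩
        exact ⟨⟨hcS t ((hmem t).2 ⟨ht, h0⟩) htz, ht.2⟩, h0⟩
      · rintro ⟨ht, h0⟩
        exact ⟨(hzc.trans ht.1).ne', ⟨(haz.trans hzc).trans ht.1, ht.2⟩, h0⟩
    rw [← Finset.add_sum_erase S _ hzS, mul_add, h1, h2]
    ring

/-- The sign changes of a continuous function on an interval add up to half the difference of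
its signs at the ends. -/
theorem two_mul_finsum_crossIndex {φ : ℝ → ℝ} (hφ : Continuous φ) {a b : ℝ} (hab : a < b)
    (ha : φ a ≠ 0) (hb : φ b ≠ 0) (hfin : {t | t ∈ Set.Ioo a b ∧ φ t = 0}.Finite) :
    2 * ∑ᶠ t ∈ {t | t ∈ Set.Ioo a b ∧ φ t = 0}, crossIndex φ t
      = (SignType.sign (φ b) : ℤ) - (SignType.sign (φ a) : ℤ) := by
  rw [finsum_mem_eq_finite_toFinset_sum _ hfin]
  exact two_mul_sum_crossIndex hφ hb _ hab ha _ rfl fun t => by simp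

/-! ### The local coincidence index as a sign change -/

theorem coe_mem_posSide_iff {r : ℝ} (hr : |r| < 1 / 2) : (r : UnitAddCircle) ∈ posSide ↔ 0 < r := by
  rw [abs_lt] at hr
  refine ⟨?_, fun h => ⟨r, ⟨h, hr.2⟩, rfl⟩⟩
  rintro ⟨s, hs, h⟩
  obtain ⟨n, hn⟩ := coe_unitAddCircle_eq_zero_iff.1
    (show ((r - s : ℝ) : UnitAddCircle) = 0 by rw [AddCircle.coe_sub, sub_eq_zero]; exact h.symm)
  have h1 : (-1 : ℤ) < n := by
    have : (-1 : ℝ) < n := by linarith [hs.2]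
    exact_mod_cast this
  have h2 : (0 : ℝ) ≤ n := by exact_mod_cast (by omega : 0 ≤ n)
  linarith [hs.1]

theorem coe_mem_negSide_iff {r : ℝ} (hr : |r| < 1 / 2) : (r : UnitAddCircle) ∈ negSide ↔ r < 0 := by
  rw [abs_lt] at hr
  refine ⟨?_, fun h => ⟨r, ⟨hr.1, h⟩, rfl⟩⟩
  rintro ⟨s, hs, h⟩
  obtain ⟨n, hn⟩ := coe_unitAddCircle_eq_zero_iff.1
    (show ((r - s : ℝ) : UnitAddCircle) = 0 by rw [AddCircle.coe_sub, sub_eq_zero]; exact h.symm)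
  have h1 : n < (1 : ℤ) := by
    have : (n : ℝ) < 1 := by linarith [hs.1]
    exact_mod_cast this
  have h2 : (n : ℝ) ≤ 0 := by exact_mod_cast (by omega : n ≤ 0)
  linarith [hs.2]

/-- `D - k`, seen as a function on the real line. -/
def levelFun (D : C(UnitAddCircle, ℝ)) (k : ℤ) (t : ℝ) : ℝ :=
  D (t : UnitAddCircle) - k

theorem continuous_levelFun (D : C(UnitAddCircle, ℝ)) (k : ℤ) : Continuous (levelFun D k) :=
  (D.continuous.comp (AddCircle.continuous_mk' 1)).sub continuous_const

section Lift

variable {f : C(UnitAddCircle, UnitAddCircle)} {D : C(UnitAddCircle, ℝ)}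

theorem IsDifferenceLift.ind_coe (hD : IsDifferenceLift f D) {k : ℤ} {z : ℝ}
    (hz : levelFun D k z = 0) : ind f (z : UnitAddCircle) = crossIndex (levelFun D k) z := by
  have hval : ∀ t : ℝ, f ((z : UnitAddCircle) + (t : UnitAddCircle))
      - (f.comp antipode) ((z : UnitAddCircle) + (t : UnitAddCircle))
      = ((levelFun D k (z + t) : ℝ) : UnitAddCircle) := fun t => by
    have hk : ((k : ℝ) : UnitAddCircle) = 0 := coe_unitAddCircle_eq_zero_iff.2 ⟨k, rfl⟩
    rw [levelFun, AddCircle.coe_sub, hk, sub_zero, hD, AddCircle.coe_add]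
    rfl
  have hev : ∀ᶠ t in 𝓝 (0 : ℝ), |levelFun D k (z + t)| < 1 / 2 := by
    have hc : Continuous fun t => |levelFun D k (z + t)| :=
      ((continuous_levelFun D k).comp (by fun_prop)).abs
    refine hc.continuousAt.eventually_lt continuousAt_const ?_
    simp [hz]
  have hp : ∀ l ≤ 𝓝 (0 : ℝ), (∀ᶠ t : ℝ in l, f ((z : UnitAddCircle) + (t : UnitAddCircle))
      - (f.comp antipode) ((z : UnitAddCircle) + (t : UnitAddCircle)) ∈ posSide) ↔
      ∀ᶠ t in l, 0 < levelFun D k (z + t) := fun l hl =>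
    Filter.eventually_congr <| (hev.filter_mono hl).mono fun t ht => by
      rw [hval, coe_mem_posSide_iff ht]
  have hn : ∀ l ≤ 𝓝 (0 : ℝ), (∀ᶠ t : ℝ in l, f ((z : UnitAddCircle) + (t : UnitAddCircle))
      - (f.comp antipode) ((z : UnitAddCircle) + (t : UnitAddCircle)) ∈ negSide) ↔
      ∀ᶠ t in l, levelFun D k (z + t) < 0 := fun l hl =>
    Filter.eventually_congr <| (hev.filter_mono hl).mono fun t ht => by
      rw [hval, coe_mem_negSide_iff ht]
  classical
  unfold ind localIndex crossIndex
  exact if_congr (and_congr (hn _ nhdsWithin_le_nhds) (hp _ nhdsWithin_le_nhds)) rfl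
    (if_congr (and_congr (hp _ nhdsWithin_le_nhds) (hn _ nhdsWithin_le_nhds)) rfl rfl)

theorem IsDifferenceLift.ind_antipode (hD : IsDifferenceLift f D) {k : ℤ}
    (hk : ∀ x, D x + D (antipode x) = 2 * k) {x : UnitAddCircle} (hx : D x = k) :
    ind f (antipode x) = -ind f x := by
  obtain ⟨z, rfl⟩ := QuotientAddGroup.mk_surjective x
  have h0 : ∀ t, levelFun D k (z + 1 / 2 + t) = -levelFun D k (z + t) := fun t => by
    have := hk ((z + t : ℝ) : UnitAddCircle)
    rw [antipode_coe] at this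
    rw [levelFun, levelFun, show z + 1 / 2 + t = z + t + 1 / 2 by ring]
    linarith
  have hz : levelFun D k z = 0 := sub_eq_zero.2 hx
  have hz' : levelFun D k (z + 1 / 2) = 0 := by simpa [hz] using h0 0
  change ind f (antipode (z : UnitAddCircle)) = -ind f (z : UnitAddCircle)
  rw [antipode_coe, hD.ind_coe hz, hD.ind_coe hz', crossIndex_eq_neg h0]

/-! ### Sums of indices over coincidence classes -/

theorem coe_injOn_Ico (u : ℝ) :
    Set.InjOn ((↑) : ℝ → UnitAddCircle) (Set.Ico u (u + 1)) := fun _ hx _ hy h =>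
  (AddCircle.coe_eq_coe_iff_of_mem_Ico hx hy).1 h

theorem exists_coe_mem_Ico (u : ℝ) (x : UnitAddCircle) :
    ∃ t ∈ Set.Ico u (u + 1), (t : UnitAddCircle) = x := by
  have : x ∈ ((↑) : ℝ → UnitAddCircle) '' Set.Ico u (u + 1) := by
    rw [AddCircle.coe_image_Ico_eq]; trivial
  exact this

theorem IsDifferenceLift.exists_levelFun_ne_zero (hD : IsDifferenceLift f D)
    (hfin : (coin f antipode).Finite) (k : ℤ) : ∃ u, levelFun D k u ≠ 0 := by
  by_contra! h
  refine Set.Ico_infinite (lt_add_one (0 : ℝ))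
    (Set.Finite.of_finite_image (hfin.subset ?_) (coe_injOn_Ico 0))
  rintro _ ⟨t, -, rfl⟩
  exact hD.mem_coin_iff.2 ⟨k, sub_eq_zero.1 (h t)⟩

theorem IsDifferenceLift.finite_zeros (hD : IsDifferenceLift f D)
    (hfin : (coin f antipode).Finite) (k : ℤ) {u v : ℝ} (hv : v ≤ u + 1) :
    {t | t ∈ Set.Ioo u v ∧ levelFun D k t = 0}.Finite := by
  have hsub : {t | t ∈ Set.Ioo u v ∧ levelFun D k t = 0} ⊆ Set.Ico u (u + 1) :=
    fun t ht => ⟨ht.1.1.le, ht.1.2.trans_le hv⟩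
  refine Set.Finite.of_finite_image (hfin.subset ?_) ((coe_injOn_Ico u).mono hsub)
  rintro _ ⟨t, ht, rfl⟩
  exact hD.mem_coin_iff.2 ⟨k, sub_eq_zero.1 ht.2⟩

/-- The indices on a level set of `D`, that is, on a usual coincidence class, add up to `0`, since
`D` is periodic. Hence no double class is essential. -/
theorem IsDifferenceLift.finsum_ind_level (hD : IsDifferenceLift f D)
    (hfin : (coin f antipode).Finite) (k : ℤ) : ∑ᶠ x ∈ {x | D x = k}, ind f x = 0 := by
  obtain ⟨u, hu⟩ := hD.exists_levelFun_ne_zero hfin k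
  have hper : levelFun D k (u + 1) = levelFun D k u := by
    have h1 : ((1 : ℝ) : UnitAddCircle) = 0 := AddCircle.coe_period 1
    simp only [levelFun, AddCircle.coe_add, h1, add_zero]
  have h := two_mul_finsum_crossIndex (continuous_levelFun D k) (lt_add_one u) hu
    (by rwa [hper]) (hD.finite_zeros hfin k le_rfl)
  rw [hper, sub_self] at h
  have hbij : Set.BijOn ((↑) : ℝ → UnitAddCircle)
      {t | t ∈ Set.Ioo u (u + 1) ∧ levelFun D k t = 0} {x | D x = k} := by
    refine ⟨fun t ht => sub_eq_zero.1 ht.2,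
      (coe_injOn_Ico u).mono fun t ht => Set.Ioo_subset_Ico_self ht.1, fun x hx => ?_⟩
    obtain ⟨t, ht, rfl⟩ := exists_coe_mem_Ico u x
    have h0 : levelFun D k t = 0 := sub_eq_zero.2 hx
    refine ⟨t, ⟨⟨lt_of_le_of_ne ht.1 ?_, ht.2⟩, h0⟩, rfl⟩
    rintro rfl
    exact hu h0
  rw [← finsum_mem_eq_of_bijOn _ hbij fun t ht => (hD.ind_coe ht.2).symm]
  omega

/-- The Borsuk-Ulam class of the pairs at level `k`, where `2 * k` is the constant `D + D ∘ τ`,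
has odd index sum: `D - k` is odd, so it changes sign between the ends of a half circle, and an
open half circle with no zero at its ends contains exactly one point of each pair. -/
theorem IsDifferenceLift.odd_finsum_ind_out (hD : IsDifferenceLift f D)
    (hfin : (coin f antipode).Finite) {k : ℤ} (hk : ∀ x, D x + D (antipode x) = 2 * k) :
    Odd (∑ᶠ p ∈ {p | p ∈ buCoin f antipode ∧ ∃ x ∈ p, D x = k}, ind f p.out.1) := by
  obtain ⟨u, hu⟩ := hD.exists_levelFun_ne_zero hfin k
  have hodd : ∀ t, levelFun D k (t + 1 / 2) = -levelFun D k t := fun t => by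
    have := hk (t : UnitAddCircle)
    rw [antipode_coe] at this
    rw [levelFun, levelFun]
    linarith
  have hu' : levelFun D k (u + 1 / 2) ≠ 0 := by rw [hodd]; exact neg_ne_zero.2 hu
  have hZ : {t | t ∈ Set.Ioo u (u + 1 / 2) ∧ levelFun D k t = 0}.Finite :=
    hD.finite_zeros hfin k (by linarith)
  have h := two_mul_finsum_crossIndex (continuous_levelFun D k) (by linarith) hu hu' hZ
  have hN : Odd (∑ᶠ t ∈ {t | t ∈ Set.Ioo u (u + 1 / 2) ∧ levelFun D k t = 0},
      crossIndex (levelFun D k) t) := by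
    rw [hodd, Left.sign_neg] at h
    rcases lt_or_gt_of_ne hu with h1 | h1
    · rw [sign_neg h1] at h
      exact ⟨0, by rw [neg_neg] at h; change _ = (1 : ℤ) - (-1) at h; omega⟩
    · rw [sign_pos h1] at h
      exact ⟨-1, by change _ = (-1 : ℤ) - 1 at h; omega⟩
  have hlevel : ∀ t : ℝ, levelFun D k t = 0 → D (t : UnitAddCircle) = k :=
    fun t ht => sub_eq_zero.1 ht
  have hbij : Set.BijOn (fun t : ℝ => s((t : UnitAddCircle), antipode (t : UnitAddCircle)))
      {t | t ∈ Set.Ioo u (u + 1 / 2) ∧ levelFun D k t = 0}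
      {p | p ∈ buCoin f antipode ∧ ∃ x ∈ p, D x = k} := by
    refine ⟨?_, ?_, ?_⟩
    · exact fun t ht => ⟨mem_buCoin_of_mem_coin (hD.mem_coin_iff.2 ⟨k, hlevel t ht.2⟩), _,
        Sym2.mem_mk_left _ _, hlevel t ht.2⟩
    · intro s hs t ht hst
      rcases Sym2.eq_iff.1 hst with ⟨h1, -⟩ | ⟨h1, -⟩
      · exact coe_injOn_Ico u ⟨hs.1.1.le, by linarith [hs.1.2]⟩ ⟨ht.1.1.le, by linarith [ht.1.2]⟩ h1
      · rw [antipode_coe] at h1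
        have := coe_injOn_Ico u ⟨hs.1.1.le, by linarith [hs.1.2]⟩
          ⟨by linarith [ht.1.1], by linarith [ht.1.2]⟩ h1
        linarith [hs.1.2, ht.1.1]
    · rintro p ⟨hp, x, hx, hxk⟩
      obtain ⟨t, ht, rfl⟩ := exists_coe_mem_Ico u x
      have h0 : levelFun D k t = 0 := sub_eq_zero.2 hxk
      have htu : t ≠ u := by rintro rfl; exact hu h0
      have htu' : t ≠ u + 1 / 2 := by rintro rfl; exact hu' h0
      rw [eq_mk_antipode hp hx]
      rcases lt_or_gt_of_ne htu' with h1 | h1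
      · exact ⟨t, ⟨⟨lt_of_le_of_ne ht.1 htu.symm, h1⟩, h0⟩, rfl⟩
      · have h2 : antipode ((t - 1 / 2 : ℝ) : UnitAddCircle) = t := by
          rw [antipode_coe, sub_add_cancel]
        have h3 : antipode (t : UnitAddCircle) = ((t - 1 / 2 : ℝ) : UnitAddCircle) := by
          rw [← h2, antipode_antipode]
        have h4 : levelFun D k (t - 1 / 2) = 0 := by
          have := hodd (t - 1 / 2)
          rw [sub_add_cancel, h0] at this
          linarith
        refine ⟨t - 1 / 2, ⟨⟨by linarith, by linarith [ht.2]⟩, h4⟩, ?_⟩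
        dsimp only
        rw [h2, h3]
        exact Sym2.eq_swap
  rw [← finsum_mem_eq_of_bijOn (f := fun t : ℝ =>
    ind f (s((t : UnitAddCircle), antipode (t : UnitAddCircle))).out.1) _ hbij fun t _ => rfl]
  rw [finsum_mem_eq_finite_toFinset_sum _ hZ] at hN ⊢
  -- Replacing a point of a pair by the other one changes the sign of the index, not its parity.
  have hev : Even (∑ t ∈ hZ.toFinset, ind f (s((t : UnitAddCircle), antipode t)).out.1
      - ∑ t ∈ hZ.toFinset, crossIndex (levelFun D k) t) := by
    rw [← Finset.sum_sub_distrib]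
    refine Finset.even_sum _ fun t ht => ?_
    have h0 : levelFun D k t = 0 := (hZ.mem_toFinset.1 ht).2
    rw [← hD.ind_coe h0]
    rcases Sym2.mem_iff.1 (Sym2.out_fst_mem s((t : UnitAddCircle), antipode t)) with h1 | h1
    · rw [h1, sub_self]
      exact Even.zero
    · rw [h1, hD.ind_antipode hk (hlevel t h0)]
      exact ⟨-ind f (t : UnitAddCircle), by ring⟩
  rw [← Int.not_even_iff_odd] at hN ⊢
  rwa [Int.even_sub.1 hev]

end Lift

/-! ### Counting essential classes -/

section Lift

variable {f : C(UnitAddCircle, UnitAddCircle)} {D : C(UnitAddCircle, ℝ)}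

theorem IsDifferenceLift.pseudoIndex_eq_zero (hD : IsDifferenceLift f D)
    (hfin : (coin f antipode).Finite) {C : Set (Sym2 UnitAddCircle)}
    (hC : C ∈ buClasses f antipode) (hs : ¬IsSingle f antipode C) : pseudoIndex f C = 0 := by
  obtain ⟨p, hp, rfl⟩ := hC
  have hpp : p ∈ buClass f antipode p :=
    (hD.mem_buClass_iff hp).2 ⟨hp, _, Sym2.out_fst_mem p, _, Sym2.out_fst_mem p, rfl⟩
  have hmem := Classical.epsilon_spec (p := fun q => q ∈ buClass f antipode p) ⟨p, hpp⟩
  have hx : basePoint (buClass f antipode p) ∈ coin f antipode :=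
    mem_coin_of_mem hmem.1 (Sym2.out_fst_mem _)
  obtain ⟨k, hk⟩ := hD.mem_coin_iff.1 hx
  have hcl : coinClass f antipode (basePoint (buClass f antipode p)) = {x | D x = k} := by
    ext y
    rw [hD.mem_coinClass_iff hx, hk]
    rfl
  rw [pseudoIndex, if_neg hs, hcl, hD.finsum_ind_level hfin, abs_zero]

theorem IsDifferenceLift.exists_level_of_isSingle (hD : IsDifferenceLift f D) {c : ℤ}
    (hc : ∀ x, D x + D (antipode x) = c) {C : Set (Sym2 UnitAddCircle)}
    (hs : IsSingle f antipode C) : ∃ k : ℤ, c = 2 * k ∧ ∃ q ∈ C, ∃ x ∈ q, D x = k := by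
  obtain ⟨q, hq, γ, h0, h1, h⟩ := hs
  obtain ⟨h2, h3⟩ := (hD.isLinkingPath_iff γ).1 h
  obtain ⟨k, hk⟩ := hD.mem_coin_iff.1 h3
  refine ⟨k, ?_, q, hq, _, h0, hk⟩
  have h4 := hc (γ 0)
  rw [← h1, ← h2, hk] at h4
  have : (c : ℝ) = ((2 * k : ℤ) : ℝ) := by push_cast; linarith
  exact_mod_cast this

theorem eq_level_of_mem {k : ℤ} (hk : ∀ x, D x + D (antipode x) = 2 * k) {p : Sym2 UnitAddCircle}
    (hp : p ∈ buCoin f antipode) {x y : UnitAddCircle} (hx : x ∈ p) (hy : y ∈ p) (hxk : D x = k) :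
    D y = k := by
  rw [eq_mk_antipode hp hx] at hy
  rcases Sym2.mem_iff.1 hy with rfl | rfl
  · exact hxk
  · linarith [hk x]

theorem IsDifferenceLift.buClass_eq_level (hD : IsDifferenceLift f D) {k : ℤ}
    (hk : ∀ x, D x + D (antipode x) = 2 * k) {p : Sym2 UnitAddCircle}
    (hp : p ∈ buCoin f antipode) {x : UnitAddCircle} (hx : x ∈ p) (hxk : D x = k) :
    buClass f antipode p = {q | q ∈ buCoin f antipode ∧ ∃ y ∈ q, D y = k} := by
  ext q
  rw [hD.mem_buClass_iff hp]
  refine and_congr_right fun hq => ⟨?_, ?_⟩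
  · rintro ⟨x', hx', y, hy, h⟩
    exact ⟨y, hy, h ▸ eq_level_of_mem hk hp hx hx' hxk⟩
  · rintro ⟨y, hy, h⟩
    exact ⟨x, hx, y, hy, hxk.trans h.symm⟩

/-- The only class that can be essential is the one at the level `c / 2`; it is present, and
essential, exactly when `c` is even. -/
theorem IsDifferenceLift.essentialCount_eq (hD : IsDifferenceLift f D) {c : ℤ}
    (hc : ∀ x, D x + D (antipode x) = c) (hfin : (buCoin f antipode).Finite) :
    essentialCount f = if Even c then 1 else 0 := by
  have hcoin := finite_coin hfin
  split_ifs with heven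
  · obtain ⟨k, rfl⟩ := (even_iff_exists_two_mul).1 heven
    have hk : ∀ x, D x + D (antipode x) = 2 * k := fun x => by rw [hc x]; push_cast; rfl
    have hodd := hD.odd_finsum_ind_out hcoin hk
    set C₀ : Set (Sym2 UnitAddCircle) := {p | p ∈ buCoin f antipode ∧ ∃ x ∈ p, D x = k} with hC₀
    obtain ⟨p, hp, x, hx, hxk⟩ : C₀.Nonempty := by
      rw [Set.nonempty_iff_ne_empty]
      intro h
      rw [h, finsum_mem_empty] at hodd
      exact absurd hodd (by decide)
    have hsingle : IsSingle f antipode C₀ := by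
      obtain ⟨γ, rfl, h1⟩ := exists_path_map x (antipode x)
      refine ⟨p, ⟨hp, _, hx, hxk⟩, γ, hx, h1, (hD.isLinkingPath_iff γ).2 ⟨?_, mem_coin_of_mem hp hx⟩⟩
      rw [h1]
      linarith [hk (γ 0)]
    rw [essentialCount, Set.ncard_eq_one]
    refine ⟨C₀, Set.Subset.antisymm ?_ ?_⟩
    · rintro C ⟨hC, hne⟩
      have hs : IsSingle f antipode C := by
        by_contra hs
        exact hne (hD.pseudoIndex_eq_zero hcoin hC hs)
      obtain ⟨m, hm, q, hq, y, hy, hym⟩ := hD.exists_level_of_isSingle hc hs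
      obtain rfl : k = m := by omega
      obtain ⟨p', hp', rfl⟩ := hC
      obtain ⟨hqc, x', hx', y', hy', h⟩ := (hD.mem_buClass_iff hp').1 hq
      exact hD.buClass_eq_level hk hp' hx' (h.trans (eq_level_of_mem hk hqc hy hy' hym))
    · rintro _ rfl
      refine ⟨⟨p, hp, hD.buClass_eq_level hk hp hx hxk⟩, ?_⟩
      rw [pseudoIndex, if_pos hsingle, Int.odd_iff.1 hodd]
      exact one_ne_zero
  · have : {C | C ∈ buClasses f antipode ∧ pseudoIndex f C ≠ 0} = ∅ := by
      rw [Set.eq_empty_iff_forall_notMem]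
      rintro C ⟨hC, hne⟩
      refine hne (hD.pseudoIndex_eq_zero hcoin hC fun hs => heven ?_)
      obtain ⟨k, hk, -⟩ := hD.exists_level_of_isSingle hc hs
      exact hk ▸ even_two_mul k
    rw [essentialCount, this, Set.ncard_empty]

theorem IsDifferenceLift.essentialCount_eq_of_homotopic (hD : IsDifferenceLift f D) {c : ℤ}
    (hc : ∀ x, D x + D (antipode x) = c) {g : C(UnitAddCircle, UnitAddCircle)}
    (hfg : ContinuousMap.Homotopic f g) (hfin : (buCoin g antipode).Finite) :
    essentialCount g = if Even c then 1 else 0 := by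
  obtain ⟨u, hu⟩ := exists_lift_sub_of_homotopic hfg
  refine (hD.of_lift_sub hu).essentialCount_eq (fun x => ?_) hfin
  simp only [ContinuousMap.sub_apply, ContinuousMap.add_apply, ContinuousMap.comp_apply,
    antipode_antipode]
  linarith [hc x]

/-! ### Minimal representatives -/

/-- The function `x ↦ sin (2 * π * x) / 2` on the circle. -/
def halfSin : C(UnitAddCircle, ℝ) where
  toFun x := (AddCircle.toCircle x : ℂ).im / 2
  continuous_toFun :=
    (Complex.continuous_im.comp
      (continuous_subtype_val.comp AddCircle.continuous_toCircle)).div_const 2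

theorem halfSin_coe (t : ℝ) : halfSin (t : UnitAddCircle) = Real.sin (2 * Real.pi * t) / 2 := by
  simp only [halfSin, ContinuousMap.coe_mk, AddCircle.toCircle_apply_mk, Circle.coe_exp, div_one,
    Complex.exp_ofReal_mul_I_im]

theorem halfSin_antipode (x : UnitAddCircle) : halfSin (antipode x) = -halfSin x := by
  obtain ⟨t, rfl⟩ := QuotientAddGroup.mk_surjective x
  rw [antipode_coe, halfSin_coe, halfSin_coe,
    show 2 * Real.pi * (t + 1 / 2) = 2 * Real.pi * t + Real.pi by ring, Real.sin_add_pi]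
  ring

theorem abs_halfSin_lt_one (x : UnitAddCircle) : |halfSin x| < 1 := by
  obtain ⟨t, rfl⟩ := QuotientAddGroup.mk_surjective x
  rw [halfSin_coe, abs_lt]
  constructor <;> linarith [Real.sin_le_one (2 * Real.pi * t), Real.neg_one_le_sin (2 * Real.pi * t)]

theorem halfSin_zero : halfSin 0 = 0 := by
  simpa using halfSin_coe 0

theorem mem_pair_of_halfSin_eq_zero {x : UnitAddCircle} (h : halfSin x = 0) :
    x = 0 ∨ x = antipode 0 := by
  obtain ⟨t, rfl⟩ := QuotientAddGroup.mk_surjective x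
  change halfSin (t : UnitAddCircle) = 0 at h
  change (t : UnitAddCircle) = 0 ∨ (t : UnitAddCircle) = antipode 0
  rw [halfSin_coe, div_eq_zero_iff, or_iff_left two_ne_zero, Real.sin_eq_zero_iff] at h
  obtain ⟨n, hn⟩ := h
  have ht : t = n / 2 := by
    have := Real.pi_ne_zero
    field_simp
    have h2 : Real.pi * n = Real.pi * (t * 2) := by linarith
    exact (mul_left_cancel₀ this h2).symm
  rcases Int.even_or_odd' n with ⟨m, rfl | rfl⟩
  · left
    exact coe_unitAddCircle_eq_zero_iff.2 ⟨m, by rw [ht]; push_cast; ring⟩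
  · right
    rw [← sub_eq_zero, show antipode 0 = ((1 / 2 : ℝ) : UnitAddCircle) by simp [antipode],
      ← AddCircle.coe_sub]
    exact coe_unitAddCircle_eq_zero_iff.2 ⟨m, by rw [ht]; push_cast; ring⟩

/-- The odd part `D - c / 2` of `D` can be replaced by any odd function `E`: move `f` by half the
difference of the two. -/
theorem IsDifferenceLift.exists_homotopic (hD : IsDifferenceLift f D) {c : ℤ}
    (hc : ∀ x, D x + D (antipode x) = c) {E : C(UnitAddCircle, ℝ)}
    (hE : ∀ x, E (antipode x) = -E x) :
    ∃ g, ContinuousMap.Homotopic f g ∧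
      ∃ D' : C(UnitAddCircle, ℝ), IsDifferenceLift g D' ∧ ∀ x, D' x = c / 2 + E x := by
  let u : C(UnitAddCircle, ℝ) := ⟨fun x => (E x - (D x - c / 2)) / 2, by fun_prop⟩
  have hco : Continuous fun r : ℝ => (r : UnitAddCircle) := AddCircle.continuous_mk' 1
  let g : C(UnitAddCircle, UnitAddCircle) :=
    ⟨fun x => f x + (u x : UnitAddCircle), f.continuous.add (hco.comp u.continuous)⟩
  have hu : ∀ x, (u x : UnitAddCircle) = g x - f x := fun x => by simp [g]
  refine ⟨g, homotopic_of_lift_sub u hu, _, hD.of_lift_sub hu, fun x => ?_⟩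
  simp only [u, ContinuousMap.sub_apply, ContinuousMap.add_apply, ContinuousMap.comp_apply,
    ContinuousMap.coe_mk, hE]
  linarith [hc x]

theorem IsDifferenceLift.exists_homotopic_ncard_eq (hD : IsDifferenceLift f D) {c : ℤ}
    (hc : ∀ x, D x + D (antipode x) = c) :
    ∃ g, ContinuousMap.Homotopic f g ∧ (buCoin g antipode).Finite ∧
      (buCoin g antipode).ncard = if Even c then 1 else 0 := by
  split_ifs with heven
  · obtain ⟨k, rfl⟩ := (even_iff_exists_two_mul).1 heven
    obtain ⟨g, hfg, D', hD', hval⟩ := hD.exists_homotopic hc halfSin_antipode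
    have hcoin : coin g antipode = {0, antipode 0} := by
      ext x
      rw [hD'.mem_coin_iff, hval]
      constructor
      · rintro ⟨n, hn⟩
        have h1 : halfSin x = ((n - k : ℤ) : ℝ) := by push_cast at hn ⊢; linarith
        have h2 := abs_halfSin_lt_one x
        rw [h1, ← Int.cast_abs] at h2
        have h3 : |n - k| < 1 := by exact_mod_cast h2
        rw [Int.abs_lt_one_iff.1 h3, Int.cast_zero] at h1
        exact mem_pair_of_halfSin_eq_zero h1
      · intro hx
        have h1 : halfSin x = 0 := by
          rcases hx with rfl | rfl
          · exact halfSin_zero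
          · rw [halfSin_antipode, halfSin_zero, neg_zero]
        exact ⟨k, by rw [h1]; push_cast; ring⟩
    have hbu : buCoin g antipode = {s(0, antipode 0)} := by
      rw [buCoin, hcoin, Set.image_pair, antipode_antipode, Sym2.eq_swap (a := antipode 0),
        Set.pair_eq_singleton]
    exact ⟨g, hfg, by rw [hbu]; exact Set.finite_singleton _, by rw [hbu, Set.ncard_singleton]⟩
  · obtain ⟨g, hfg, D', hD', hval⟩ := hD.exists_homotopic hc (E := 0) (fun x => by simp)
    have hcoin : coin g antipode = ∅ := by
      rw [Set.eq_empty_iff_forall_notMem]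
      intro x hx
      obtain ⟨n, hn⟩ := hD'.mem_coin_iff.1 hx
      rw [hval, ContinuousMap.zero_apply, add_zero] at hn
      have h1 : (c : ℝ) = ((2 * n : ℤ) : ℝ) := by push_cast; linarith
      have h2 : c = 2 * n := by exact_mod_cast h1
      exact heven (h2 ▸ even_two_mul n)
    have hbu : buCoin g antipode = ∅ := by rw [buCoin, hcoin, Set.image_empty]
    exact ⟨g, hfg, by rw [hbu]; exact Set.finite_empty, by rw [hbu, Set.ncard_empty]⟩

end Lift

end NielsenBorsukUlam

end

open NielsenBorsukUlam in
/-- The first two conjuncts say that `NBU f` is well defined: some map homotopic to `f` has finite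
Borsuk-Ulam coincidence set, and all such maps have `NBU f` essential classes. -/
theorem theorem3p1 (f : C(UnitAddCircle, UnitAddCircle)) :
    (∃ g : C(UnitAddCircle, UnitAddCircle),
      ContinuousMap.Homotopic f g ∧ (buCoin g antipode).Finite) ∧
    (∀ g : C(UnitAddCircle, UnitAddCircle),
      ContinuousMap.Homotopic f g → (buCoin g antipode).Finite → essentialCount g = NBU f) ∧
    (∀ a : ℤ, InducesMul f a → NBU f = if Even a then 1 else 0) ∧
    (∃ f' : C(UnitAddCircle, UnitAddCircle), ContinuousMap.Homotopic f f' ∧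
      (buCoin f' antipode).Finite ∧ (buCoin f' antipode).ncard = NBU f) := by
  obtain ⟨D, hD⟩ := exists_isDifferenceLift f
  obtain ⟨c, hc⟩ := hD.exists_add_antipode
  obtain ⟨g₀, hg₀, hfin₀, hcard₀⟩ := hD.exists_homotopic_ncard_eq hc
  have hNBU : NBU f = if Even c then 1 else 0 := by
    obtain ⟨h1, h2⟩ := Classical.epsilon_spec
      (p := fun g => ContinuousMap.Homotopic f g ∧ (buCoin g antipode).Finite) ⟨g₀, hg₀, hfin₀⟩
    exact hD.essentialCount_eq_of_homotopic hc h1 h2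
  refine ⟨⟨g₀, hg₀, hfin₀⟩, fun g hg hfin => ?_, fun a ha => ?_, g₀, hg₀, hfin₀, ?_⟩
  · rw [hNBU, hD.essentialCount_eq_of_homotopic hc hg hfin]
  · rw [hNBU, if_congr (ha.even_iff hD hc) rfl rfl]
  · rw [hNBU, hcard₀]
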